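/- Let $\mathcal H$ be a complex Hilbert space with an orthonormal basis $(|n\rangle)_{n\in\mathbb N}$, $\mathbb N=\{0,1,2,\dots\}$ (the number basis), and let $e^{i\theta N}$ be the unitary operator with $e^{i\theta N}|n\rangle=e^{i\theta n}|n\rangle$. A POVM $E:\mathcal B(\mathbb R)\to\mathcal L(\mathcal H)$ is a weakly $\sigma$-additive map into the positive bounded operators with $E(\mathbb R)=I$. It is a covariant phase observable if $E([0,2\pi))=I$ and $e^{i\theta N}E(X)e^{-i\theta N}=E(X\dot+\theta)$ for all Borel $X\subseteq[0,2\pi)$ and all $\theta\in\mathbb R$, where $\dot+$ is addition modulo $2\pi$. The canonical phase observable $E_{\mathrm{can}}$ is the unique operator measure with phase matrix $c_{m,n}\equiv1$, that is, with $$\langle m|E_{\mathrm{can}}(X)|n\rangle=\frac1{2\pi}\int_{X\cap[0,2\pi)}e^{i(m-n)\theta}\,d\theta\qquad(m,n\in\mathbb N,\ X\in\mathcal B(\mathbb R)).$$ Then: 1. $E_{\mathrm{can}}$ is an extreme point of the convex set of all POVMs $\mathcal B(\mathbb R)\to\mathcal L(\mathcal H)$: if $E_{\mathrm{can}}=\lambda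 E_1+(1-\lambda)E_2$ with POVMs $E_1,E_2$ and $0<\lambda<1$, then $E_1=E_2=E_{\mathrm{can}}$. 2. In particular, $E_{\mathrm{can}}$ is a covariant phase observable, and an extreme point of the convex set of covariant phase observables. 3. $E_{\mathrm{can}}$ is not a spectral measure, that is, $E_{\mathrm{can}}(X)$ is not an orthogonal projection for some Borel set $X$. -/

import Mathlib

noncomputable section

open MeasureTheory
open scoped ComplexOrder InnerProductSpace

namespace PhaseObs

variable {H : Type*} [NormedAddCommGroup H] [InnerProductSpace ℂ H] [CompleteSpace H]

/-! ### Positive operator measures -/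

/-- Weakly `σ`-additive measures on `Ω` with values in the bounded operators on `H`:
vector measures for the weak operator topology on `𝓛(H)`. (Vector measures in Mathlib take
the value `0` on non-measurable sets, so that two of them are equal as soon as they agree on
the measurable sets.) They form a real vector space. -/
abbrev OpMeasure (Ω : Type*) [MeasurableSpace Ω] (H : Type*) [NormedAddCommGroup H]
    [InnerProductSpace ℂ H] : Type _ :=
  VectorMeasure Ω (H →WOT[ℂ] H)

/-- The set of all (normalized) positive operator measures `𝓑(Ω) → 𝓛(H)`. -/
def POVM (Ω : Type*) [MeasurableSpace Ω] (H : Type*) [NormedAddCommGroup H]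
    [InnerProductSpace ℂ H] : Set (OpMeasure Ω H) :=
  {E | (∀ X : Set Ω, MeasurableSet X → (E X).toCLM.IsPositive) ∧ E Set.univ = 1}

/-- A spectral (projection valued) measure: a positive operator measure all of whose values are
orthogonal projections. -/
def IsSpectralMeasure {Ω : Type*} [MeasurableSpace Ω] (E : OpMeasure Ω H) : Prop :=
  E ∈ POVM Ω H ∧ ∀ X : Set Ω, MeasurableSet X → IsStarProjection (E X).toCLM

/-- The positive operator measures form a convex set. -/
theorem convex_POVM (Ω : Type*) [MeasurableSpace Ω] : Convex ℝ (POVM Ω H) := by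
  rintro E ⟨hE, hE1⟩ F ⟨hF, hF1⟩ s t hs ht hst
  refine ⟨fun X hX => ?_, ?_⟩
  · have h1 : ((s : ℂ) • (E X).toCLM).IsPositive :=
      (hE X hX).smul_of_nonneg (by exact_mod_cast hs)
    have h2 : ((t : ℂ) • (F X).toCLM).IsPositive :=
      (hF X hX).smul_of_nonneg (by exact_mod_cast ht)
    have h3 := h1.add h2
    convert! h3 using 1
  · change s • E Set.univ + t • F Set.univ = 1
    rw [hE1, hF1]
    exact Convex.combo_self hst _

/-! ### Covariant phase observables -/

/-- The operator `e^{iθN}`, where `N` is the number operator of the number basis `b`. It maps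
`b n` to `e^{iθn} b n`; in coordinates it multiplies the `n`-th one by `e^{iθn}`. -/
theorem exists_phaseShift (b : HilbertBasis ℕ ℂ H) (θ : ℝ) :
    ∃ U : H ≃ₗᵢ[ℂ] H, ∀ n : ℕ, U (b n) = Complex.exp (Complex.I * θ * n) • b n := by
  have hnorm : ∀ n : ℕ, ‖Complex.exp (Complex.I * θ * n)‖ = 1 := fun n => by
    rw [show Complex.I * θ * n = ((θ * n : ℝ) : ℂ) * Complex.I by push_cast; ring]
    exact Complex.norm_exp_ofReal_mul_I _
  have ho : Orthonormal ℂ (fun n : ℕ => Complex.exp (Complex.I * θ * n) • b n) := by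
    refine ⟨fun n => by rw [norm_smul, hnorm, b.orthonormal.1, one_mul], fun m n hmn => ?_⟩
    simp only [inner_smul_left, inner_smul_right]
    rw [b.orthonormal.2 hmn]; simp
  have hsp : ⊤ ≤ (Submodule.span ℂ (Set.range
      (fun n : ℕ => Complex.exp (Complex.I * θ * n) • b n))).topologicalClosure := by
    rw [← b.dense_span]
    refine Submodule.topologicalClosure_mono (Submodule.span_le.2 ?_)
    rintro _ ⟨n, rfl⟩
    have h := Submodule.smul_mem (Submodule.span ℂ (Set.range
      (fun n : ℕ => Complex.exp (Complex.I * θ * n) • b n)))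
      (Complex.exp (Complex.I * θ * n))⁻¹ (Submodule.subset_span ⟨n, rfl⟩)
    simpa [smul_smul, Complex.exp_ne_zero] using h
  refine ⟨b.repr.trans (HilbertBasis.mk ho hsp).repr.symm, fun n => ?_⟩
  classical
  rw [LinearIsometryEquiv.trans_apply, b.repr_self, HilbertBasis.repr_symm_single,
    HilbertBasis.coe_mk]

/-- The unitary operator `e^{iθN}`: the one that maps `b n` to `e^{iθn} b n` for all `n`. -/
def phaseShift (b : HilbertBasis ℕ ℂ H) (θ : ℝ) : H ≃ₗᵢ[ℂ] H :=
  (exists_phaseShift b θ).choose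

theorem phaseShift_basis (b : HilbertBasis ℕ ℂ H) (θ : ℝ) (n : ℕ) :
    phaseShift b θ (b n) = Complex.exp (Complex.I * θ * n) • b n :=
  (exists_phaseShift b θ).choose_spec n

/-- For `X ⊆ [0, 2π)`, the set `X ∔ θ` of all sums modulo `2π` of a point of `X` and `θ`. -/
def shiftMod (X : Set ℝ) (θ : ℝ) : Set ℝ :=
  {t | t ∈ Set.Ico 0 (2 * Real.pi) ∧ toIcoMod Real.two_pi_pos 0 (t - θ) ∈ X}

/-- The covariant phase observables: positive operator measures on `[0, 2π)` (that is, on `ℝ`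
and concentrated on `[0, 2π)`) with `e^{iθN} E(X) e^{-iθN} = E(X ∔ θ)`. -/
def covariantPhaseObservables (b : HilbertBasis ℕ ℂ H) : Set (OpMeasure ℝ H) :=
  {E | E ∈ POVM ℝ H ∧ E (Set.Ico 0 (2 * Real.pi)) = 1 ∧
    ∀ X : Set ℝ, MeasurableSet X → X ⊆ Set.Ico 0 (2 * Real.pi) →
      ∀ (θ : ℝ) (ψ : H), phaseShift b θ (E X ((phaseShift b θ).symm ψ)) = E (shiftMod X θ) ψ}

/-- The covariant phase observables form a convex set. -/
theorem convex_covariantPhaseObservables (b : HilbertBasis ℕ ℂ H) :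
    Convex ℝ (covariantPhaseObservables b) := by
  rintro E ⟨hE, hE1, hE2⟩ F ⟨hF, hF1, hF2⟩ s t hs ht hst
  refine ⟨convex_POVM ℝ hE hF hs ht hst, ?_, fun X hX hXs θ ψ => ?_⟩
  · change s • E _ + t • F _ = 1
    rw [hE1, hF1]
    exact Convex.combo_self hst _
  · change phaseShift b θ ((s : ℂ) • E X _ + (t : ℂ) • F X _) =
      (s : ℂ) • E (shiftMod X θ) ψ + (t : ℂ) • F (shiftMod X θ) ψ
    rw [map_add, map_smul, map_smul, hE2 X hX hXs, hF2 X hX hXs]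

/-- `E(X) = ∑_{m,n} c_{m,n} (1/2π) ∫_X e^{i(m-n)θ} dθ |m⟩⟨n|`, the integral being over the
part of `X` in `[0, 2π)`. Here `|n⟩ = b n`, and the series is understood through its matrix
elements, which determine a bounded operator. -/
def HasPhaseMatrix (b : HilbertBasis ℕ ℂ H) (c : ℕ → ℕ → ℂ) (E : OpMeasure ℝ H) : Prop :=
  ∀ X : Set ℝ, MeasurableSet X → ∀ m n : ℕ,
    ⟪b m, E X (b n)⟫_ℂ = c m n * ((1 / (2 * Real.pi)) *
      ∫ θ in X ∩ Set.Ico 0 (2 * Real.pi), Complex.exp (Complex.I * ((m : ℂ) - n) * θ))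

/-- A bounded operator is determined by its matrix elements. -/
theorem ext_basis (b : HilbertBasis ℕ ℂ H) {S T : H →L[ℂ] H}
    (h : ∀ m n : ℕ, ⟪b m, S (b n)⟫_ℂ = ⟪b m, T (b n)⟫_ℂ) : S = T := by
  have hd : Dense ((Submodule.span ℂ (Set.range b) : Submodule ℂ H) : Set H) :=
    Submodule.dense_iff_topologicalClosure_eq_top.2 b.dense_span
  refine ContinuousLinearMap.ext_on hd ?_
  rintro _ ⟨n, rfl⟩
  refine b.repr.injective (lp.ext (funext fun m => ?_))
  rw [b.repr_apply_apply, b.repr_apply_apply, h]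

theorem HasPhaseMatrix.unique (b : HilbertBasis ℕ ℂ H) {c : ℕ → ℕ → ℂ} {E F : OpMeasure ℝ H}
    (hE : HasPhaseMatrix b c E) (hF : HasPhaseMatrix b c F) : E = F := by
  refine VectorMeasure.ext fun X hX => ContinuousLinearMapWOT.toCLM_injective ?_
  exact ext_basis b fun m n => (hE X hX m n).trans (hF X hX m n).symm

/-! ### Existence of the operator measure with phase matrix `1` -/

/-- Normalized Lebesgue measure on `[0, 2π)`. -/
def circMeasure : Measure ℝ :=
  ENNReal.ofReal (1 / (2 * Real.pi)) • volume.restrict (Set.Ico 0 (2 * Real.pi))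

instance : IsFiniteMeasure circMeasure := by
  unfold circMeasure
  exact Measure.smul_finite _ ENNReal.ofReal_ne_top

theorem setIntegral_circ (X : Set ℝ) (hX : MeasurableSet X) (f : ℝ → ℂ) :
    ∫ t in X, f t ∂circMeasure =
      (1 / (2 * Real.pi)) * ∫ t in X ∩ Set.Ico 0 (2 * Real.pi), f t := by
  have h0 : (0 : ℝ) ≤ 1 / (2 * Real.pi) := by positivity
  rw [circMeasure, Measure.restrict_smul, Measure.restrict_restrict hX, integral_smul_measure,
    ENNReal.toReal_ofReal h0, Complex.real_smul]
  push_cast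
  rfl

/-- The function `t ↦ e^{-int}`. -/
def expFun (n : ℕ) (t : ℝ) : ℂ := Complex.exp (-(Complex.I * n * t))

theorem memLp_expFun (n : ℕ) : MemLp (expFun n) 2 circMeasure := by
  have hc : Continuous (expFun n) := by unfold expFun; fun_prop
  refine MemLp.of_bound hc.aestronglyMeasurable 1 (Filter.Eventually.of_forall fun t => ?_)
  rw [expFun, show -(Complex.I * n * t) = ((-(n * t) : ℝ) : ℂ) * Complex.I by push_cast; ring,
    Complex.norm_exp_ofReal_mul_I]

def expLp (n : ℕ) : Lp ℂ 2 circMeasure := (memLp_expFun n).toLp _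

theorem inner_expFun (m n : ℕ) (t : ℝ) :
    ⟪expFun m t, expFun n t⟫_ℂ = Complex.exp (Complex.I * ((m : ℂ) - n) * t) := by
  simp only [RCLike.inner_apply, expFun, ← Complex.exp_conj, map_neg, map_mul, Complex.conj_I,
    Complex.conj_ofReal, map_natCast, ← Complex.exp_add]
  congr 1
  ring

theorem setIntegral_inner_expLp (X : Set ℝ) (hX : MeasurableSet X) (m n : ℕ) :
    ∫ t in X, ⟪expLp m t, expLp n t⟫_ℂ ∂circMeasure = (1 / (2 * Real.pi)) *
      ∫ θ in X ∩ Set.Ico 0 (2 * Real.pi), Complex.exp (Complex.I * ((m : ℂ) - n) * θ) := by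
  rw [← setIntegral_circ X hX]
  refine integral_congr_ae (ae_restrict_of_ae ?_)
  filter_upwards [(memLp_expFun m).coeFn_toLp, (memLp_expFun n).coeFn_toLp] with t h1 h2
  rw [expLp, expLp, h1, h2, inner_expFun]

theorem integral_exp_circ (m n : ℕ) :
    (1 / (2 * Real.pi)) * ∫ θ in Set.Ico 0 (2 * Real.pi),
      Complex.exp (Complex.I * ((m : ℂ) - n) * θ) = if m = n then 1 else 0 := by
  rw [integral_Ico_eq_integral_Ioc, ← intervalIntegral.integral_of_le Real.two_pi_pos.le]
  have hpi : (Real.pi : ℂ) ≠ 0 := by exact_mod_cast Real.pi_ne_zero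
  split_ifs with h
  · subst h
    simp only [sub_self, mul_zero, zero_mul, Complex.exp_zero, intervalIntegral.integral_const,
      sub_zero, Complex.real_smul, mul_one]
    push_cast
    field_simp
  · have hne : Complex.I * ((m : ℂ) - n) ≠ 0 :=
      mul_ne_zero Complex.I_ne_zero (sub_ne_zero.2 (by exact_mod_cast h))
    rw [integral_exp_mul_complex hne]
    have h1 : Complex.exp (Complex.I * ((m : ℂ) - n) * ((2 * Real.pi : ℝ) : ℂ)) = 1 := by
      rw [Complex.exp_eq_one_iff]
      exact ⟨(m : ℤ) - n, by push_cast; ring⟩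
    rw [h1]
    simp

theorem orthonormal_expLp : Orthonormal ℂ expLp := by
  rw [orthonormal_iff_ite]
  intro m n
  have h := setIntegral_inner_expLp Set.univ MeasurableSet.univ m n
  rw [Set.univ_inter, integral_exp_circ, setIntegral_univ] at h
  rw [L2.inner_def, h]

/-- The isometry `H → L²` with `b n ↦ e^{-int}`. -/
def embed (b : HilbertBasis ℕ ℂ H) : H →ₗᵢ[ℂ] Lp ℂ 2 circMeasure :=
  (orthonormal_expLp.orthogonalFamily.linearIsometry).comp b.repr.toLinearIsometry

theorem embed_basis (b : HilbertBasis ℕ ℂ H) (n : ℕ) : embed b (b n) = expLp n := by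
  classical
  change orthonormal_expLp.orthogonalFamily.linearIsometry (b.repr (b n)) = expLp n
  rw [b.repr_self, OrthogonalFamily.linearIsometry_apply_single]
  simp

/-- Restriction to `X` after the embedding into `L²`. -/
def restrictEmbed (b : HilbertBasis ℕ ℂ H) (X : Set ℝ) :
    H →L[ℂ] Lp ℂ 2 (circMeasure.restrict X) :=
  (LpToLpRestrictCLM ℝ ℂ ℂ circMeasure 2 X).comp (embed b).toContinuousLinearMap

/-- The compression to `H` of the multiplication by the indicator function of `X`. -/
def compress (b : HilbertBasis ℕ ℂ H) (X : Set ℝ) : H →L[ℂ] H :=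
  (restrictEmbed b X).adjoint.comp (restrictEmbed b X)

theorem inner_compress (b : HilbertBasis ℕ ℂ H) (X : Set ℝ) (φ ψ : H) :
    ⟪φ, compress b X ψ⟫_ℂ = ∫ t in X, ⟪embed b φ t, embed b ψ t⟫_ℂ ∂circMeasure := by
  rw [compress, ContinuousLinearMap.comp_apply, ContinuousLinearMap.adjoint_inner_right,
    L2.inner_def]
  refine integral_congr_ae ?_
  filter_upwards [LpToLpRestrictCLM_coeFn ℂ X (embed b φ),
    LpToLpRestrictCLM_coeFn ℂ X (embed b ψ)] with t h1 h2
  simp only [restrictEmbed, ContinuousLinearMap.comp_apply,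
    LinearIsometry.coe_toContinuousLinearMap]
  rw [h1, h2]

open Classical in
/-- The operator measure `X ↦ compress b X`. -/
def compressMeasure (b : HilbertBasis ℕ ℂ H) : OpMeasure ℝ H where
  measureOf' X := if MeasurableSet X then .ofCLM (compress b X) else 0
  empty' := by
    rw [if_pos MeasurableSet.empty]
    refine ContinuousLinearMapWOT.ext_inner fun x y => ?_
    change ⟪y, compress b ∅ x⟫_ℂ = ⟪y, (0 : H)⟫_ℂ
    rw [inner_compress]
    simp
  not_measurable' X hX := if_neg hX
  m_iUnion' f hf hd := by
    rw [HasSum, ContinuousLinearMapWOT.tendsto_iff_forall_inner_apply_tendsto]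
    intro x y
    have key := hasSum_integral_iUnion hf hd
      (L2.integrable_inner (𝕜 := ℂ) (embed b y) (embed b x)).integrableOn
    rw [HasSum] at key
    rw [if_pos (MeasurableSet.iUnion hf)]
    simp only [hf, if_true]
    change Filter.Tendsto _ _ (nhds ⟪y, compress b (⋃ i, f i) x⟫_ℂ)
    rw [inner_compress]
    refine key.congr fun s => ?_
    have h1 : (∑ i ∈ s, ContinuousLinearMapWOT.ofCLM (compress b (f i)) : H →WOT[ℂ] H) x =
        ∑ i ∈ s, compress b (f i) x := by
      induction s using Finset.induction_on with
      | empty => rfl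
      | insert a s ha ih => rw [Finset.sum_insert ha, Finset.sum_insert ha, ← ih]; rfl
    rw [h1, inner_sum]
    exact Finset.sum_congr rfl fun i _ => (inner_compress b (f i) y x).symm

theorem compressMeasure_apply (b : HilbertBasis ℕ ℂ H) {X : Set ℝ} (hX : MeasurableSet X) :
    compressMeasure b X = .ofCLM (compress b X) :=
  if_pos hX

theorem hasPhaseMatrix_compressMeasure (b : HilbertBasis ℕ ℂ H) :
    HasPhaseMatrix b (fun _ _ => 1) (compressMeasure b) := by
  intro X hX m n
  rw [compressMeasure_apply b hX, ContinuousLinearMapWOT.ofCLM_apply, inner_compress,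
    embed_basis, embed_basis, setIntegral_inner_expLp X hX, one_mul]

/-- There is exactly one operator measure with phase matrix `c_{m,n} ≡ 1`. -/
theorem existsUnique_hasPhaseMatrix_one (b : HilbertBasis ℕ ℂ H) :
    ∃! E : OpMeasure ℝ H, HasPhaseMatrix b (fun _ _ => 1) E :=
  ⟨compressMeasure b, hasPhaseMatrix_compressMeasure b,
    fun _ hE => hE.unique b (hasPhaseMatrix_compressMeasure b)⟩

/-- The canonical phase observable `E_can`: the operator measure with phase matrix
`c_{m,n} ≡ 1`. -/
def canonicalPhase (b : HilbertBasis ℕ ℂ H) : OpMeasure ℝ H :=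
  (existsUnique_hasPhaseMatrix_one b).choose

theorem hasPhaseMatrix_canonicalPhase (b : HilbertBasis ℕ ℂ H) :
    HasPhaseMatrix b (fun _ _ => 1) (canonicalPhase b) :=
  (existsUnique_hasPhaseMatrix_one b).choose_spec.1

end PhaseObs

end

/-!
# Extremality of the canonical phase observable

Let `c` be the normalized Lebesgue measure on `[0, 2π)`. If `canonicalPhase b` is a proper convex
combination of positive operator measures, each of them, say `E`, satisfies
`⟪φ, E(X) φ⟫ ≤ C ⟪φ, E_can(X) φ⟫` with a constant `C`, so it is enough to show that a normalized `E`
with this property is `E_can` (`eq_canonicalPhase_of_le`).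

On a set `X` contained in a short interval `[t₀, t₀ + δ]`, the vectors `b n - e^{-int₀} b 0` are
almost annihilated by `E_can(X)`, hence by `E(X)`: their `E(X)`-energy is at most
`C (nδ)² c(X)`. By Cauchy–Schwarz, `⟪b m, E(X) b n⟫` differs from
`e^{i(m-n)t₀} ⟪b 0, E(X) b 0⟫` by `O(δ c(X))`. Cutting an arbitrary set into pieces of length `δ`
and letting `δ → 0` gives `⟪b m, E(X) b n⟫ = ∫_X e^{i(m-n)t} dμ(t)`, where `μ = ⟪b 0, E(·) b 0⟫`
(`inner_eq_setIntegral_of_le_canonicalPhase`). In other words, `E` is determined by one scalar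
measure, as the densities of `E_can` have rank one. Normalization of `E` now says that `μ` has the
Fourier coefficients of `c`; every integer occurs as a difference `m - n`, so `μ = c` by uniqueness
of Fourier coefficients (`measure_eq_of_fourier`), and `E = E_can`.

The canonical phase is covariant because the functions `e^{i(m-n)t}` are `2π`-periodic, and
extremality among all positive operator measures passes to the convex subset of covariant ones.

For the last part, the matrix of `P = E_can(X)` is a Toeplitz matrix on `ℕ`. If `P` is a projection,
the squared norm of its column `n` is the diagonal entry `⟪b n, P (b n)⟫`. The columns `0` and `1`
have the same diagonal entry, but column `1` is column `0` shifted down with one new entry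
`⟪b 0, P (b 1)⟫`, which therefore vanishes; for `X = [0, π)` it does not.
-/

noncomputable section

open MeasureTheory
open scoped ComplexOrder InnerProductSpace

namespace PhaseObs

/-! ### Two general facts: Cauchy–Schwarz and uniqueness of Fourier coefficients -/

/-- The Cauchy–Schwarz inequality for the form `⟪x, T y⟫` of a positive operator. -/
theorem norm_inner_sq_le {H : Type*} [NormedAddCommGroup H] [InnerProductSpace ℂ H]
    [CompleteSpace H] {T : H →L[ℂ] H} (hT : T.IsPositive) (x y : H) :
    ‖⟪x, T y⟫_ℂ‖ ^ 2 ≤ (⟪x, T x⟫_ℂ).re * (⟪y, T y⟫_ℂ).re := by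
  obtain ⟨S, rfl⟩ := CStarAlgebra.nonneg_iff_eq_star_mul_self.1
    ((ContinuousLinearMap.nonneg_iff_isPositive T).2 hT)
  have h : ∀ x y : H, ⟪x, (star S * S) y⟫_ℂ = ⟪S x, S y⟫_ℂ := fun x y => by
    rw [ContinuousLinearMap.star_eq_adjoint, mul_apply_eq_comp,
      ContinuousLinearMap.adjoint_inner_right]
  have hn : ∀ x : H, (⟪S x, S x⟫_ℂ).re = ‖S x‖ ^ 2 := fun x => by
    rw [inner_self_eq_norm_sq_to_K]; norm_cast
  rw [h, h, h, hn, hn, ← mul_pow]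
  gcongr
  exact norm_inner_le_norm _ _

/-- Finite measures on `[0, 2π)` with equal Fourier coefficients are equal. The measures are
transported to the circle, where trigonometric polynomials separate points. -/
theorem measure_eq_of_fourier {μ ν : Measure ℝ} [IsFiniteMeasure μ] [IsFiniteMeasure ν]
    (hμ : μ (Set.Ico 0 (2 * Real.pi))ᶜ = 0) (hν : ν (Set.Ico 0 (2 * Real.pi))ᶜ = 0)
    (h : ∀ k : ℤ, ∫ t, Complex.exp (Complex.I * k * t) ∂μ =
      ∫ t, Complex.exp (Complex.I * k * t) ∂ν) : μ = ν := by
  have : Fact (0 < 2 * Real.pi) := ⟨Real.two_pi_pos⟩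
  have hmeas : Measurable ((↑) : ℝ → AddCircle (2 * Real.pi)) :=
    (AddCircle.continuous_mk' _).measurable
  have hk : ∀ (ρ : Measure ℝ) (k : ℤ),
      ∫ z, fourier k z ∂(ρ.map ((↑) : ℝ → AddCircle (2 * Real.pi))) =
        ∫ t, Complex.exp (Complex.I * k * t) ∂ρ := by
    intro ρ k
    rw [integral_map hmeas.aemeasurable (fourier k).continuous.aestronglyMeasurable]
    refine integral_congr_ae (Filter.Eventually.of_forall fun t => ?_)
    simp only [fourier_coe_apply]
    congr 1
    have : (Real.pi : ℂ) ≠ 0 := by exact_mod_cast Real.pi_ne_zero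
    push_cast
    field_simp
  have hmap : μ.map ((↑) : ℝ → AddCircle (2 * Real.pi)) = ν.map (↑) := by
    refine ext_of_forall_mem_subalgebra_integral_eq_of_pseudoEMetric_complete_countable (𝕜 := ℂ)
      (A := (fourierSubalgebra (T := 2 * Real.pi)).comap
        (BoundedContinuousFunction.toContinuousMapStarₐ ℂ)) ?_ ?_
    · intro x y hxy
      obtain ⟨_, ⟨f, hf, rfl⟩, hne⟩ := fourierSubalgebra_separatesPoints hxy
      exact ⟨_, ⟨f, ⟨BoundedContinuousFunction.mkOfCompact f, hf, rfl⟩, rfl⟩, hne⟩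
    · intro g hg
      have hg' : (g : C(AddCircle (2 * Real.pi), ℂ)) ∈
          Submodule.span ℂ (Set.range (@fourier (2 * Real.pi))) := by
        rw [← fourierSubalgebra_coe]; exact hg
      have hint : ∀ (ρ : Measure (AddCircle (2 * Real.pi))) [IsFiniteMeasure ρ]
          (f : C(AddCircle (2 * Real.pi), ℂ)), Integrable f ρ := fun ρ _ f =>
        (BoundedContinuousFunction.mkOfCompact f).integrable ρ
      suffices H : ∀ f ∈ Submodule.span ℂ (Set.range (@fourier (2 * Real.pi))),
          ∫ z, f z ∂(μ.map ((↑) : ℝ → AddCircle (2 * Real.pi))) = ∫ z, f z ∂(ν.map (↑)) from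
        H _ hg'
      intro f hf
      induction hf using Submodule.span_induction with
      | mem f hf =>
        obtain ⟨k, rfl⟩ := hf
        rw [hk, hk, h]
      | zero => simp
      | add f g _ _ hf hg =>
        simp only [ContinuousMap.add_apply]
        rw [integral_add (hint _ f) (hint _ g), integral_add (hint _ f) (hint _ g), hf, hg]
      | smul c f _ hf =>
        simp only [ContinuousMap.smul_apply]
        rw [integral_smul, integral_smul, hf]
  -- A measure concentrated on `[0, 2π)` can be read off from its image on the circle.
  have hr : ∀ (ρ : Measure ℝ), ρ (Set.Ico 0 (2 * Real.pi))ᶜ = 0 → ∀ X, MeasurableSet X →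
      ρ X = ρ.map ((↑) : ℝ → AddCircle (2 * Real.pi))
        ((fun z => (AddCircle.measurableEquivIco (2 * Real.pi) 0 z : ℝ)) ⁻¹' X) := by
    intro ρ hρ X hX
    rw [Measure.map_apply hmeas (((AddCircle.measurableEquivIco (2 * Real.pi)
      0).measurable.subtype_val) hX)]
    refine measure_congr ?_
    filter_upwards [compl_mem_ae_iff.2 hρ] with t ht
    rw [compl_compl] at ht
    refine propext ?_
    change t ∈ X ↔ (AddCircle.equivIco (2 * Real.pi) 0 (t : AddCircle (2 * Real.pi)) : ℝ) ∈ X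
    rw [show (AddCircle.equivIco (2 * Real.pi) 0 (t : AddCircle (2 * Real.pi)) : ℝ) = t from
      (toIcoMod_eq_self Real.two_pi_pos).2 (by simpa using ht)]
  ext X hX
  rw [hr μ hμ X hX, hr ν hν X hX, hmap]

/-! ### Vector measures that are small on short intervals -/

/-- If `‖ν X‖ ≤ K δ μ(X)` whenever `X` lies in an interval of length `δ`, then `ν = 0`: cutting any
`X` into countably many such pieces gives the same bound for `X`, for every `δ > 0`. -/
theorem eq_zero_of_norm_le_mul_measure {ν : VectorMeasure ℝ ℂ} {μ : Measure ℝ} [IsFiniteMeasure μ]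
    {K : ℝ} (hK : ∀ δ > 0, ∀ t₀ : ℝ, ∀ X : Set ℝ, MeasurableSet X → X ⊆ Set.Icc t₀ (t₀ + δ) →
      ‖ν X‖ ≤ K * δ * μ.real X) : ν = 0 := by
  have key : ∀ X, MeasurableSet X → ∀ δ > 0, ‖ν X‖ ≤ K * δ * μ.real X := by
    intro X hX δ hδ
    have hfl : Measurable fun t : ℝ => ⌊t / δ⌋ := (measurable_id.div_const δ).floor
    let c : ℤ → Set ℝ := fun k => X ∩ (fun t : ℝ => ⌊t / δ⌋) ⁻¹' {k}
    have hcm : ∀ k, MeasurableSet (c k) := fun k => hX.inter (hfl (measurableSet_singleton k))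
    have hcd : Pairwise (Function.onFun Disjoint c) := fun k l hkl =>
      (Disjoint.preimage _ (by simpa using hkl)).mono Set.inter_subset_right Set.inter_subset_right
    have hcU : ⋃ k, c k = X := by
      ext t
      simp [c]
    have hcs : ∀ k, c k ⊆ Set.Icc (k * δ) (k * δ + δ) := by
      rintro k t ⟨-, ht⟩
      obtain ⟨h1, h2⟩ := Int.floor_eq_iff.1 (show ⌊t / δ⌋ = k from ht)
      rw [le_div_iff₀ hδ] at h1
      rw [div_lt_iff₀ hδ] at h2
      exact ⟨h1, by linarith⟩
    have hν := VectorMeasure.hasSum_of_disjoint_iUnion (v := ν) hcm hcd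
    have hμ : HasSum (fun k => μ.real (c k)) (μ.real X) := by
      have h := hasSum_integral_iUnion hcm hcd (μ := μ) (f := fun _ => (1 : ℝ))
        (integrable_const _).integrableOn
      simpa [hcU] using h
    rw [hcU] at hν
    rw [← hν.tsum_eq]
    exact tsum_of_norm_bounded (hμ.mul_left (K * δ)) fun k => hK δ hδ _ _ (hcm k) (hcs k)
  refine VectorMeasure.ext fun X hX => ?_
  have hlim : Filter.Tendsto (fun δ : ℝ => K * δ * μ.real X)
      (nhdsWithin 0 (Set.Ioi 0)) (nhds 0) := by
    have : Continuous fun δ : ℝ => K * δ * μ.real X := by fun_prop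
    simpa using (this.tendsto 0).mono_left nhdsWithin_le_nhds
  have := ge_of_tendsto hlim
    (Filter.eventually_of_mem self_mem_nhdsWithin fun δ hδ => key X hX δ hδ)
  simpa using this

/-! ### Bounds for exponentials -/

theorem norm_exp_sub_exp_le (c t t₀ : ℝ) :
    ‖Complex.exp (Complex.I * c * t) - Complex.exp (Complex.I * c * t₀)‖ ≤ |c| * |t - t₀| := by
  have h : Complex.exp (Complex.I * c * t) - Complex.exp (Complex.I * c * t₀) =
      Complex.exp ((c * t₀ : ℝ) * Complex.I) *
        (Complex.exp (Complex.I * (c * (t - t₀) : ℝ)) - 1) := by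
    rw [mul_sub, ← Complex.exp_add, mul_one]
    push_cast
    ring_nf
  rw [h, norm_mul, Complex.norm_exp_ofReal_mul_I, one_mul, ← abs_mul]
  exact Real.norm_exp_I_mul_ofReal_sub_one_le

theorem norm_expFun (n : ℕ) (t : ℝ) : ‖expFun n t‖ = 1 := by
  rw [expFun, show -(Complex.I * n * t) = ((-(n * t) : ℝ) : ℂ) * Complex.I by push_cast; ring,
    Complex.norm_exp_ofReal_mul_I]

theorem norm_expFun_sub_le (n : ℕ) (t t₀ : ℝ) :
    ‖expFun n t - expFun n t₀‖ ≤ n * |t - t₀| := by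
  have h := norm_exp_sub_exp_le (-n) t t₀
  rw [abs_neg, Nat.abs_cast] at h
  convert h using 2
  simp [expFun]

variable {H : Type*} [NormedAddCommGroup H] [InnerProductSpace ℂ H]

/-! ### Matrix elements of operator measures -/

/-- The complex measure `X ↦ ⟪φ, E(X) ψ⟫` of matrix elements of an operator measure `E`. -/
def matrixElement {Ω : Type*} [MeasurableSpace Ω] (E : OpMeasure Ω H) (φ ψ : H) :
    ComplexMeasure Ω :=
  E.mapRange
    { toFun := fun A => ⟪φ, A ψ⟫_ℂ
      map_zero' := by simp
      map_add' := fun A B => by simp }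
    (ContinuousLinearMapWOT.continuous_dual_apply ψ (innerSL ℂ φ))

theorem matrixElement_apply {Ω : Type*} [MeasurableSpace Ω] (E : OpMeasure Ω H) (φ ψ : H)
    (X : Set Ω) : matrixElement E φ ψ X = ⟪φ, E X ψ⟫_ℂ := rfl

/-- The diagonal matrix elements of a positive operator measure form a finite positive measure. -/
theorem exists_measure_matrixElement_self {Ω : Type*} [MeasurableSpace Ω] {E : OpMeasure Ω H}
    (hE : ∀ X : Set Ω, MeasurableSet X → (E X).toCLM.IsPositive) (φ : H) :
    ∃ μ : Measure Ω, IsFiniteMeasure μ ∧ ∀ X, MeasurableSet X → ⟪φ, E X φ⟫_ℂ = μ.real X := by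
  let s : SignedMeasure Ω :=
    (matrixElement E φ φ).mapRange Complex.reAddGroupHom Complex.continuous_re
  have hs : ∀ X, s X = (⟪φ, E X φ⟫_ℂ).re := fun X => rfl
  have h0 : VectorMeasure.restrict 0 Set.univ ≤ VectorMeasure.restrict s Set.univ := by
    refine VectorMeasure.restrict_le_restrict_of_subset_le _ _ fun X hX _ => ?_
    rw [hs]
    exact (hE X hX).re_inner_nonneg_right φ
  refine ⟨s.toMeasureOfZeroLE Set.univ MeasurableSet.univ h0, inferInstance, fun X hX => ?_⟩
  rw [SignedMeasure.toMeasureOfZeroLE_real_apply _ _ _ hX, Set.univ_inter, hs]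
  exact Complex.ext rfl (by
    simpa using (Complex.le_def.1 ((hE X hX).inner_nonneg_right φ)).2.symm)

variable [CompleteSpace H]

/-! ### The canonical phase as a compression of a multiplication operator -/

theorem canonicalPhase_apply (b : HilbertBasis ℕ ℂ H) {X : Set ℝ} (hX : MeasurableSet X) :
    canonicalPhase b X = .ofCLM (compress b X) := by
  rw [← compressMeasure_apply b hX, (hasPhaseMatrix_canonicalPhase b).unique b
    (hasPhaseMatrix_compressMeasure b)]

theorem isPositive_canonicalPhase (b : HilbertBasis ℕ ℂ H) {X : Set ℝ} (hX : MeasurableSet X) :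
    (canonicalPhase b X).toCLM.IsPositive := by
  rw [canonicalPhase_apply b hX]
  exact ContinuousLinearMap.isPositive_adjoint_comp_self _

theorem re_inner_canonicalPhase (b : HilbertBasis ℕ ℂ H) {X : Set ℝ} (hX : MeasurableSet X)
    (φ : H) : (⟪φ, canonicalPhase b X φ⟫_ℂ).re = ∫ t in X, ‖embed b φ t‖ ^ 2 ∂circMeasure := by
  rw [canonicalPhase_apply b hX, ContinuousLinearMapWOT.ofCLM_apply, inner_compress]
  simp only [inner_self_eq_norm_sq_to_K]
  have : ∀ t, ((‖embed b φ t‖ : ℂ)) ^ 2 = ((‖embed b φ t‖ ^ 2 : ℝ) : ℂ) :=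
    fun t => by push_cast; rfl
  simp only [Complex.coe_algebraMap, this]
  rw [integral_complex_ofReal, Complex.ofReal_re]

/-- The energy estimate: if `e^{-int}` is within `r` of the constant `c` on `X`, then `embed b` maps
`b n - c b 0` to a function of modulus at most `r` on `X`. It is used with `c = e^{-int₀}` on short
intervals, and with `c = 0`, `r = 1` for the basis vectors themselves. -/
theorem re_inner_canonicalPhase_le (b : HilbertBasis ℕ ℂ H) {X : Set ℝ} (hX : MeasurableSet X)
    (n : ℕ) (c : ℂ) {r : ℝ} (hr : ∀ t ∈ X, ‖expFun n t - c‖ ≤ r) :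
    (⟪b n - c • b 0, canonicalPhase b X (b n - c • b 0)⟫_ℂ).re ≤ r ^ 2 * circMeasure.real X := by
  rw [re_inner_canonicalPhase b hX, map_sub, map_smul, embed_basis, embed_basis]
  have hae : ∀ᵐ t ∂(circMeasure.restrict X),
      ‖(expLp n - c • expLp 0 : Lp ℂ 2 circMeasure) t‖ ^ 2 ≤ r ^ 2 := by
    rw [ae_restrict_iff' hX]
    filter_upwards [Lp.coeFn_sub (expLp n) (c • expLp 0), Lp.coeFn_smul c (expLp 0),
      (memLp_expFun n).coeFn_toLp, (memLp_expFun 0).coeFn_toLp] with t h1 h2 h3 h4 ht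
    have h5 : expFun 0 t = 1 := by simp [expFun]
    rw [h1, Pi.sub_apply, h2, Pi.smul_apply, expLp, expLp, h3, h4, h5, smul_eq_mul, mul_one]
    exact pow_le_pow_left₀ (norm_nonneg _) (hr t ht) 2
  calc _ ≤ ∫ _ in X, r ^ 2 ∂circMeasure :=
        integral_mono_of_nonneg (Filter.Eventually.of_forall fun t => by positivity)
          (integrable_const _) hae
    _ = _ := by rw [setIntegral_const, smul_eq_mul, mul_comm]

theorem circMeasure_compl_Ico : circMeasure (Set.Ico 0 (2 * Real.pi))ᶜ = 0 := by
  rw [circMeasure, Measure.smul_apply, Measure.restrict_apply measurableSet_Ico.compl]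
  simp

theorem inner_canonicalPhase_basis (b : HilbertBasis ℕ ℂ H) {X : Set ℝ} (hX : MeasurableSet X)
    (m n : ℕ) : ⟪b m, canonicalPhase b X (b n)⟫_ℂ =
      ∫ t in X, Complex.exp (Complex.I * ((m : ℤ) - n : ℤ) * t) ∂circMeasure := by
  rw [hasPhaseMatrix_canonicalPhase b X hX m n, setIntegral_circ X hX, one_mul]
  push_cast
  rfl

theorem integrable_exp (μ : Measure ℝ) [IsFiniteMeasure μ] (k : ℤ) :
    Integrable (fun t : ℝ => Complex.exp (Complex.I * k * t)) μ := by
  refine Integrable.of_bound (C := 1) (by fun_prop) (Filter.Eventually.of_forall fun t => ?_)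
  rw [show Complex.I * k * t = ((k * t : ℝ) : ℂ) * Complex.I by push_cast; ring,
    Complex.norm_exp_ofReal_mul_I]

/-! ### Operator measures dominated by the canonical phase -/

/-- A positive operator measure dominated by a multiple of the canonical phase is determined by its
diagonal matrix element `μ` at `b 0`, through the densities `e^{i(m-n)t}`. -/
theorem inner_eq_setIntegral_of_le_canonicalPhase (b : HilbertBasis ℕ ℂ H) {E : OpMeasure ℝ H}
    (hE : ∀ X : Set ℝ, MeasurableSet X → (E X).toCLM.IsPositive) {C : ℝ} (hC : 0 ≤ C)
    (hle : ∀ X : Set ℝ, MeasurableSet X → ∀ φ : H,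
      (⟪φ, E X φ⟫_ℂ).re ≤ C * (⟪φ, canonicalPhase b X φ⟫_ℂ).re)
    {μ : Measure ℝ} [IsFiniteMeasure μ]
    (hμ : ∀ X, MeasurableSet X → ⟪b 0, E X (b 0)⟫_ℂ = μ.real X) (m n : ℕ)
    {X : Set ℝ} (hX : MeasurableSet X) :
    ⟪b m, E X (b n)⟫_ℂ = ∫ t in X, Complex.exp (Complex.I * ((m : ℤ) - n : ℤ) * t) ∂μ := by
  set f : ℝ → ℂ := fun t => Complex.exp (Complex.I * ((m : ℤ) - n : ℤ) * t) with hf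
  have hfi : Integrable f μ := integrable_exp μ _
  suffices h : matrixElement E (b m) (b n) - μ.withDensityᵥ f = 0 by
    have h' := congrArg (fun ν : VectorMeasure ℝ ℂ => ν X) h
    simp only [sub_apply, zero_apply] at h'
    rw [matrixElement_apply, withDensityᵥ_apply hfi hX, sub_eq_zero] at h'
    exact h'
  refine eq_zero_of_norm_le_mul_measure (μ := circMeasure)
    (K := C * m + C * n + |(((m : ℤ) - n : ℤ) : ℝ)| * C) fun δ hδ t₀ Y hY hYs => ?_
  have hd : ∀ t ∈ Y, |t - t₀| ≤ δ := fun t ht => by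
    rw [abs_of_nonneg (sub_nonneg.2 (hYs ht).1)]
    linarith [(hYs ht).2]
  set κ := circMeasure.real Y
  have hκ : 0 ≤ κ := measureReal_nonneg
  have hq : ∀ (k : ℕ), (⟪b k, E Y (b k)⟫_ℂ).re ≤ C * κ := fun k => by
    have h := (hle Y hY (b k - (0 : ℂ) • b 0)).trans (mul_le_mul_of_nonneg_left
      (re_inner_canonicalPhase_le b hY k 0 (r := 1) fun t _ => by
        rw [sub_zero, norm_expFun]) hC)
    simpa using h
  set u : ℕ → ℂ := fun k => expFun k t₀
  have hu : ∀ k, ‖u k‖ = 1 := fun k => norm_expFun k t₀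
  have hqd : ∀ (k : ℕ), (⟪b k - u k • b 0, E Y (b k - u k • b 0)⟫_ℂ).re ≤
      C * ((k * δ) ^ 2 * κ) := fun k =>
    (hle Y hY _).trans (mul_le_mul_of_nonneg_left
      (re_inner_canonicalPhase_le b hY k (u k) fun t ht =>
        (norm_expFun_sub_le k t t₀).trans (by gcongr; exact hd t ht)) hC)
  have hqn : ∀ φ, 0 ≤ (⟪φ, E Y φ⟫_ℂ).re := fun φ => (hE Y hY).re_inner_nonneg_right φ
  have hcs : ∀ φ ψ : H, ‖⟪φ, E Y ψ⟫_ℂ‖ ^ 2 ≤ (⟪φ, E Y φ⟫_ℂ).re * (⟪ψ, E Y ψ⟫_ℂ).re :=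
    fun φ ψ => norm_inner_sq_le (hE Y hY) φ ψ
  -- Replacing `b m`, then `b n`, by a multiple of `b 0` costs `O(δ c(Y))` each.
  have h1 : ‖⟪b m - u m • b 0, E Y (b n)⟫_ℂ‖ ≤ C * m * δ * κ := by
    refine le_of_sq_le_sq ((hcs _ _).trans ((mul_le_mul (hqd m) (hq n) (hqn _)
      (by positivity)).trans_eq (by ring))) (by positivity)
  have h2 : ‖⟪b 0, E Y (b n - u n • b 0)⟫_ℂ‖ ≤ C * n * δ * κ := by
    refine le_of_sq_le_sq ((hcs _ _).trans ((mul_le_mul (hq 0) (hqd n) (hqn _)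
      (by positivity)).trans_eq (by ring))) (by positivity)
  have hft : f t₀ = star (u m) * u n := by
    have := inner_expFun m n t₀
    rw [RCLike.inner_apply, mul_comm] at this
    simp only [hf, u]
    push_cast
    exact this.symm
  have hμκ : μ.real Y ≤ C * κ := by
    have := hq 0
    rwa [hμ Y hY, Complex.ofReal_re] at this
  -- So does replacing `e^{i(m-n)t}` by its value at `t₀` in the integral.
  have h3 : ‖∫ t in Y, (f t₀ - f t) ∂μ‖ ≤ |(((m : ℤ) - n : ℤ) : ℝ)| * δ * (C * κ) := by
    refine (norm_setIntegral_le_of_norm_le_const (measure_lt_top μ Y)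
      (C := |(((m : ℤ) - n : ℤ) : ℝ)| * δ) fun t ht => ?_).trans (by gcongr)
    have := norm_exp_sub_exp_le ((m : ℤ) - n : ℤ) t₀ t
    rw [abs_sub_comm t₀ t] at this
    refine le_trans ?_ (this.trans (?_ : _ ≤ |(((m : ℤ) - n : ℤ) : ℝ)| * δ))
    · simp only [hf]; push_cast; rfl
    · gcongr; exact hd t ht
  have h4 : ∫ t in Y, (f t₀ - f t) ∂μ = f t₀ * ⟪b 0, E Y (b 0)⟫_ℂ - ∫ t in Y, f t ∂μ := by
    rw [integral_sub (integrable_const _) hfi.integrableOn, setIntegral_const, hμ Y hY,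
      Complex.real_smul, mul_comm]
  have h5 : (matrixElement E (b m) (b n) - μ.withDensityᵥ f) Y =
      ⟪b m - u m • b 0, E Y (b n)⟫_ℂ + star (u m) * ⟪b 0, E Y (b n - u n • b 0)⟫_ℂ +
        ∫ t in Y, (f t₀ - f t) ∂μ := by
    rw [h4, hft, sub_apply, matrixElement_apply, withDensityᵥ_apply hfi hY,
      inner_sub_left, inner_smul_left, map_sub, map_smul, inner_sub_right, inner_smul_right]
    simp only [RCLike.star_def]
    ring
  rw [h5]
  refine (norm_add₃_le).trans ?_
  rw [norm_mul, norm_star, hu, one_mul]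
  push_cast at h3 ⊢
  linarith

/-- A normalized positive operator measure dominated by a multiple of the canonical phase is the
canonical phase. -/
theorem eq_canonicalPhase_of_le (b : HilbertBasis ℕ ℂ H) {E : OpMeasure ℝ H}
    (hE : E ∈ POVM ℝ H) {C : ℝ} (hC : 0 ≤ C)
    (hle : ∀ X : Set ℝ, MeasurableSet X → ∀ φ : H,
      (⟪φ, E X φ⟫_ℂ).re ≤ C * (⟪φ, canonicalPhase b X φ⟫_ℂ).re) : E = canonicalPhase b := by
  obtain ⟨μ, _, hμ⟩ := exists_measure_matrixElement_self hE.1 (b 0)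
  have hmat := fun m n X hX =>
    inner_eq_setIntegral_of_le_canonicalPhase b hE.1 hC hle hμ m n (X := X) hX
  have hμ0 : μ (Set.Ico 0 (2 * Real.pi))ᶜ = 0 := by
    have hI : MeasurableSet (Set.Ico 0 (2 * Real.pi))ᶜ := measurableSet_Ico.compl
    have h := hle _ hI (b 0)
    rw [hμ _ hI, re_inner_canonicalPhase b hI,
      Measure.restrict_eq_zero.2 circMeasure_compl_Ico, integral_zero_measure, mul_zero,
      Complex.ofReal_re] at h
    exact (measureReal_eq_zero_iff).1 (h.antisymm measureReal_nonneg)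
  have hμν : μ = circMeasure := by
    refine measure_eq_of_fourier hμ0 circMeasure_compl_Ico fun k => ?_
    obtain ⟨m, n, rfl⟩ : ∃ m n : ℕ, k = (m : ℤ) - n := ⟨k.toNat, (-k).toNat, by omega⟩
    have h1 := hmat m n Set.univ MeasurableSet.univ
    have h2 := inner_canonicalPhase_basis b MeasurableSet.univ m n
    rw [setIntegral_univ] at h1 h2
    rw [← h1, ← h2, hE.2, hasPhaseMatrix_canonicalPhase b _ MeasurableSet.univ, one_mul,
      Set.univ_inter, integral_exp_circ]
    exact orthonormal_iff_ite.1 b.orthonormal m n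
  refine VectorMeasure.ext fun X hX => ContinuousLinearMapWOT.toCLM_injective ?_
  refine ext_basis b fun m n => ?_
  exact (hmat m n X hX).trans (by rw [hμν]; exact (inner_canonicalPhase_basis b hX m n).symm)

/-! ### Extremality among all positive operator measures -/

theorem canonicalPhase_eq_one_of_Ico_subset (b : HilbertBasis ℕ ℂ H) {X : Set ℝ}
    (hX : MeasurableSet X) (hXs : Set.Ico 0 (2 * Real.pi) ⊆ X) : canonicalPhase b X = 1 := by
  refine ContinuousLinearMapWOT.toCLM_injective (ext_basis b fun m n => ?_)
  refine (hasPhaseMatrix_canonicalPhase b X hX m n).trans ?_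
  rw [one_mul, Set.inter_eq_right.2 hXs, integral_exp_circ]
  exact (orthonormal_iff_ite.1 b.orthonormal m n).symm

theorem canonicalPhase_mem_POVM (b : HilbertBasis ℕ ℂ H) : canonicalPhase b ∈ POVM ℝ H :=
  ⟨fun _ hX => isPositive_canonicalPhase b hX,
    canonicalPhase_eq_one_of_Ico_subset b MeasurableSet.univ (Set.subset_univ _)⟩

theorem canonicalPhase_mem_extremePoints_POVM (b : HilbertBasis ℕ ℂ H) :
    canonicalPhase b ∈ (POVM ℝ H).extremePoints ℝ := by
  refine mem_extremePoints_iff_left.2 ⟨canonicalPhase_mem_POVM b, ?_⟩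
  rintro E hE F hF ⟨s, t, hs, ht, -, hst⟩
  refine eq_canonicalPhase_of_le b hE (C := s⁻¹) (by positivity) fun X hX φ => ?_
  have h : (⟪φ, canonicalPhase b X φ⟫_ℂ).re =
      s * (⟪φ, E X φ⟫_ℂ).re + t * (⟪φ, F X φ⟫_ℂ).re := by
    rw [← hst]
    change (⟪φ, (s : ℂ) • E X φ + (t : ℂ) • F X φ⟫_ℂ).re = _
    simp
  have hF0 : 0 ≤ (⟪φ, F X φ⟫_ℂ).re := (hF.1 X hX).re_inner_nonneg_right φ
  rw [inv_mul_eq_div, le_div_iff₀ hs, h]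
  nlinarith

/-! ### Covariance -/

theorem measurableSet_shiftMod {X : Set ℝ} (hX : MeasurableSet X) (θ : ℝ) :
    MeasurableSet (shiftMod X θ) := by
  refine measurableSet_Ico.inter (hX.preimage (f := fun t => toIcoMod Real.two_pi_pos 0 (t - θ)) ?_)
  simp only [toIcoMod_eq_add_fract_mul]
  fun_prop

theorem setIntegral_shiftMod_exp {X : Set ℝ} (hX : MeasurableSet X) (θ : ℝ) (k : ℤ) :
    ∫ t in shiftMod X θ ∩ Set.Ico 0 (2 * Real.pi), Complex.exp (Complex.I * k * t) =
      Complex.exp (Complex.I * k * θ) *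
        ∫ t in X ∩ Set.Ico 0 (2 * Real.pi), Complex.exp (Complex.I * k * t) := by
  -- The `2π`-periodic extension of the integrand on the right-hand side.
  set g : ℝ → ℂ := fun t => X.indicator (fun s : ℝ => Complex.exp (Complex.I * k * s))
    (toIcoMod Real.two_pi_pos 0 t) with hg
  have hgp : Function.Periodic g (2 * Real.pi) := fun t => by
    simp only [hg, toIcoMod_add_right]
  have hL : ∫ t in shiftMod X θ ∩ Set.Ico 0 (2 * Real.pi), Complex.exp (Complex.I * k * t) =
      ∫ t in Set.Ico 0 (2 * Real.pi), Complex.exp (Complex.I * k * θ) * g (t - θ) := by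
    rw [Set.inter_comm, ← setIntegral_indicator (measurableSet_shiftMod hX θ)]
    refine setIntegral_congr_fun measurableSet_Ico fun t ht => ?_
    by_cases h : toIcoMod Real.two_pi_pos 0 (t - θ) ∈ X
    · have hs : t ∈ shiftMod X θ := ⟨ht, h⟩
      simp only [hg, Set.indicator_of_mem hs, Set.indicator_of_mem h, ← Complex.exp_add]
      rw [← self_sub_toIcoDiv_zsmul, Complex.exp_eq_exp_iff_exists_int]
      refine ⟨k * toIcoDiv Real.two_pi_pos 0 (t - θ), ?_⟩
      push_cast [zsmul_eq_mul]
      ring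
    · have hs : t ∉ shiftMod X θ := fun hs => h hs.2
      simp only [hg, Set.indicator_of_notMem hs, Set.indicator_of_notMem h, mul_zero]
  have hR : ∫ t in X ∩ Set.Ico 0 (2 * Real.pi), Complex.exp (Complex.I * k * t) =
      ∫ t in Set.Ico 0 (2 * Real.pi), g t := by
    rw [Set.inter_comm, ← setIntegral_indicator hX]
    refine setIntegral_congr_fun measurableSet_Ico fun t ht => ?_
    simp only [hg]
    rw [(toIcoMod_eq_self Real.two_pi_pos).2 (by simpa using ht)]
  rw [hL, hR, integral_const_mul, integral_Ico_eq_integral_Ioc, integral_Ico_eq_integral_Ioc,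
    ← intervalIntegral.integral_of_le Real.two_pi_pos.le,
    ← intervalIntegral.integral_of_le Real.two_pi_pos.le, intervalIntegral.integral_comp_sub_right]
  have h := hgp.intervalIntegral_add_eq (0 - θ) 0
  rw [zero_add, show 0 - θ + 2 * Real.pi = 2 * Real.pi - θ by ring] at h
  rw [h]

theorem phaseShift_symm_basis (b : HilbertBasis ℕ ℂ H) (θ : ℝ) (n : ℕ) :
    (phaseShift b θ).symm (b n) = Complex.exp (-(Complex.I * θ * n)) • b n := by
  rw [LinearIsometryEquiv.symm_apply_eq, map_smul, phaseShift_basis, smul_smul, ← Complex.exp_add,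
    neg_add_cancel, Complex.exp_zero, one_smul]

theorem phaseShift_canonicalPhase (b : HilbertBasis ℕ ℂ H) {X : Set ℝ} (hX : MeasurableSet X)
    (θ : ℝ) (ψ : H) : phaseShift b θ (canonicalPhase b X ((phaseShift b θ).symm ψ)) =
      canonicalPhase b (shiftMod X θ) ψ := by
  have h : ((phaseShift b θ : H ≃L[ℂ] H) : H →L[ℂ] H).comp ((canonicalPhase b X).toCLM.comp
      (((phaseShift b θ).symm : H ≃L[ℂ] H) : H →L[ℂ] H)) =
        (canonicalPhase b (shiftMod X θ)).toCLM := by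
    refine ext_basis b fun m n => ?_
    change ⟪b m, phaseShift b θ (canonicalPhase b X ((phaseShift b θ).symm (b n)))⟫_ℂ =
      ⟪b m, canonicalPhase b (shiftMod X θ) (b n)⟫_ℂ
    have hs := setIntegral_shiftMod_exp hX θ ((m : ℤ) - n)
    push_cast at hs
    rw [← LinearIsometryEquiv.inner_map_map (phaseShift b θ).symm,
      LinearIsometryEquiv.symm_apply_apply, phaseShift_symm_basis, phaseShift_symm_basis,
      map_smul, inner_smul_left, inner_smul_right,
      hasPhaseMatrix_canonicalPhase b _ (measurableSet_shiftMod hX θ),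
      hasPhaseMatrix_canonicalPhase b _ hX, hs, ← Complex.exp_conj]
    have he : Complex.exp (Complex.I * ((m : ℂ) - n) * θ) =
        Complex.exp ((starRingEnd ℂ) (-(Complex.I * θ * m))) *
          Complex.exp (-(Complex.I * θ * n)) := by
      rw [← Complex.exp_add]
      simp only [map_neg, map_mul, Complex.conj_I, Complex.conj_ofReal, map_natCast]
      ring_nf
    rw [he]
    ring
  exact congrArg (fun T : H →L[ℂ] H => T ψ) h

theorem canonicalPhase_mem_covariantPhaseObservables (b : HilbertBasis ℕ ℂ H) :
    canonicalPhase b ∈ covariantPhaseObservables b :=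
  ⟨canonicalPhase_mem_POVM b,
    canonicalPhase_eq_one_of_Ico_subset b measurableSet_Ico subset_rfl,
    fun _ hX _ => phaseShift_canonicalPhase b hX⟩

theorem canonicalPhase_mem_extremePoints_covariant (b : HilbertBasis ℕ ℂ H) :
    canonicalPhase b ∈ (covariantPhaseObservables b).extremePoints ℝ :=
  inter_extremePoints_subset_extremePoints_of_subset (fun _ hE => hE.1)
    ⟨canonicalPhase_mem_covariantPhaseObservables b, canonicalPhase_mem_extremePoints_POVM b⟩

/-! ### The canonical phase is not a spectral measure -/

/-- In a Toeplitz matrix on `ℕ` that is a projection, the columns `0` and `1` have the same norm,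
as their squared norms are diagonal entries. Column `1` is column `0` shifted down below one new
entry, which must be `0`. -/
theorem inner_basis_zero_one_eq_zero_of_toeplitz (b : HilbertBasis ℕ ℂ H) {P : H →L[ℂ] H}
    (hP : IsStarProjection P)
    (hT : ∀ m n : ℕ, ⟪b (m + 1), P (b (n + 1))⟫_ℂ = ⟪b m, P (b n)⟫_ℂ) :
    ⟪b 0, P (b 1)⟫_ℂ = 0 := by
  have hsum : ∀ n, HasSum (fun m => star ⟪b m, P (b n)⟫_ℂ * ⟪b m, P (b n)⟫_ℂ)
      ⟪b n, P (b n)⟫_ℂ := fun n => by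
    have h : ⟪P (b n), P (b n)⟫_ℂ = ⟪b n, P (b n)⟫_ℂ := by
      conv_rhs => rw [← hP.isIdempotentElem.eq]
      exact (ContinuousLinearMap.isSelfAdjoint_iff_isSymmetric.1 hP.isSelfAdjoint) _ _
    have h2 := b.hasSum_inner_mul_inner (P (b n)) (P (b n))
    rw [h] at h2
    simpa using h2
  have h1 := (hasSum_nat_add_iff' 1).2 (hsum 1)
  simp only [hT _ 0, Finset.sum_range_one] at h1
  have h := h1.unique (hsum 0)
  rw [sub_eq_self, mul_eq_zero, star_eq_zero, or_self] at h
  exact h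

theorem not_isSpectralMeasure_canonicalPhase (b : HilbertBasis ℕ ℂ H) :
    ¬ IsSpectralMeasure (canonicalPhase b) := by
  rintro ⟨-, hE⟩
  have hX : MeasurableSet (Set.Ico 0 Real.pi) := measurableSet_Ico
  have h0 := inner_basis_zero_one_eq_zero_of_toeplitz b (hE _ hX) fun m n => by
    refine (hasPhaseMatrix_canonicalPhase b _ hX _ _).trans
      (Eq.trans ?_ (hasPhaseMatrix_canonicalPhase b _ hX m n).symm)
    simp
  have h1 := (hasPhaseMatrix_canonicalPhase b _ hX 0 1).symm.trans h0
  have hsub : Set.Ico 0 Real.pi ⊆ Set.Ico 0 (2 * Real.pi) :=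
    Set.Ico_subset_Ico_right (by linarith [Real.pi_pos])
  rw [Set.inter_eq_left.2 hsub, integral_Ico_eq_integral_Ioc,
    ← intervalIntegral.integral_of_le Real.pi_pos.le,
    integral_exp_mul_complex (by simp)] at h1
  have he : Complex.exp (Complex.I * (((0 : ℕ) : ℂ) - (1 : ℕ)) * (Real.pi : ℝ)) = -1 := by
    rw [show Complex.I * (((0 : ℕ) : ℂ) - (1 : ℕ)) * (Real.pi : ℝ) = -(Real.pi * Complex.I) by
      push_cast; ring, Complex.exp_neg, Complex.exp_pi_mul_I]
    norm_num
  rw [he] at h1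
  norm_num [Real.pi_ne_zero] at h1

end PhaseObs

end

theorem theorem3 {H : Type*} [NormedAddCommGroup H] [InnerProductSpace ℂ H] [CompleteSpace H]
    (b : HilbertBasis ℕ ℂ H) :
    PhaseObs.canonicalPhase b ∈ (PhaseObs.POVM ℝ H).extremePoints ℝ ∧
    PhaseObs.canonicalPhase b ∈ (PhaseObs.covariantPhaseObservables b).extremePoints ℝ ∧
    ¬ PhaseObs.IsSpectralMeasure (PhaseObs.canonicalPhase b) :=
  ⟨PhaseObs.canonicalPhase_mem_extremePoints_POVM b,
    PhaseObs.canonicalPhase_mem_extremePoints_covariant b,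
    PhaseObs.not_isSpectralMeasure_canonicalPhase b⟩
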